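/- Let $(V,\circ,e)$ be a finite-dimensional Euclidean Jordan algebra over $\mathbb R$ with identity $e$ and rank $r$: $\circ$ is bilinear and commutative, $x\circ(x^2\circ y)=x^2\circ(x\circ y)$, $x\circ e=x$, and $V$ admits an associative positive definite bilinear form. Every $x\in V$ has a spectral decomposition $x=\sum_{i=1}^r\lambda_i(x)c_i$ over a Jordan frame $c_1,\dots,c_r$. Put $\operatorname{trace}(x)=\sum_i\lambda_i(x)$ and $\|x\|=\max_i|\lambda_i(x)|$, and endow $V$ with the inner product $\langle x,y\rangle=\operatorname{trace}(x\circ y)$ and the norm $\|x\|_F=\sqrt{\langle x,x\rangle}$. Let $\Omega$ be the interior of the cone of squares $\{x^2:x\in V\}$, $\bar\Omega$ its closure, $v^+$ the projection of $v$ onto $\bar\Omega$, and $\Delta(\Omega)=\{x\in\bar\Omega:\langle e,x\rangle=1\}$. Let $P:V\to V$ be the orthogonal projection onto a linear subspace $L\subseteq V$, let $\bar u\in\Delta(\Omega)$, and for $\mu>0$ let $$u_\mu(v)=\operatorname*{argmin}_{u\in\Delta(\Omega)}\Big\{\langle u,v\rangle+\frac{\mu}{2}\|u-\bar u\|_F^2\Big\}.$$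 The smooth perceptron scheme starts with $u_0=\bar u$, $\mu_0=2$, $z_0=u_{\mu_0}(Pu_0)$, $t=0$. While $Pu_t\notin\Omega$ and $\|(Pz_t)^+\|_F>\frac1{4r}\|z_t\|$, it puts $\theta_t=\frac{2}{t+3}$ and $$u_{t+1}=(1-\theta_t)(u_t+\theta_t z_t)+\theta_t^2\,u_{\mu_t}(Pu_t),\qquad \mu_{t+1}=(1-\theta_t)\mu_t,\qquad z_{t+1}=(1-\theta_t)z_t+\theta_t\,u_{\mu_{t+1}}(Pu_{t+1}),$$ and then increases $t$ by $1$; otherwise it halts. **Proposition.** If the scheme has not halted after $t\ge1$ iterations (that is, the condition of the while loop holds at the iterates $0,1,\dots,t$), then $$\|Pz_t\|_F^2\le\frac{8}{(t+1)^2}.$$ -/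

import Mathlib

open scoped InnerProductSpace

/-- A Euclidean Jordan algebra with identity element on a real vector space `V`:
a commutative bilinear product satisfying the Jordan identity, with unit `e`, such that
there exists an associative positive definite bilinear form. -/
structure EuclideanJordanAlgebra (V : Type*) [AddCommGroup V] [Module ℝ V] where
  /-- the product `x ∘ y` -/
  mul : V →ₗ[ℝ] V →ₗ[ℝ] V
  /-- the identity element -/
  e : V
  mul_comm : ∀ x y : V, mul x y = mul y x
  jordan : ∀ x y : V, mul x (mul (mul x x) y) = mul (mul x x) (mul x y)
  mul_e : ∀ x : V, mul x e = x
  exists_form : ∃ B : V →ₗ[ℝ] V →ₗ[ℝ] ℝ,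
    (∀ x y z : V, B (mul x y) z = B x (mul y z)) ∧ ∀ x : V, x ≠ 0 → 0 < B x x

namespace EuclideanJordanAlgebra

section Algebra

variable {V : Type*} [AddCommGroup V] [Module ℝ V] (J : EuclideanJordanAlgebra V)

/-- Powers `x ^ k` in the Jordan algebra. -/
def pow (x : V) : ℕ → V
  | 0 => J.e
  | k + 1 => J.mul x (pow x k)

/-- The rank: the smallest `r` such that `e, x, ..., x ^ r` are linearly dependent
for every `x`. -/
noncomputable def rank : ℕ :=
  sInf {r : ℕ | ∀ x : V, ¬ LinearIndependent ℝ (fun i : Fin (r + 1) => J.pow x i)}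

/-- Idempotent elements. -/
def IsIdempotent (c : V) : Prop := J.mul c c = c

/-- Primitive idempotents: idempotents which are not the sum of two other idempotents. -/
def IsPrimitive (c : V) : Prop :=
  J.IsIdempotent c ∧
    ¬ ∃ a b : V, J.IsIdempotent a ∧ J.IsIdempotent b ∧ a ≠ c ∧ b ≠ c ∧ a + b = c

/-- Jordan frames: `r` nonzero primitive idempotents, pairwise orthogonal, of sum `e`. -/
def IsJordanFrame (c : Fin J.rank → V) : Prop :=
  (∀ i, c i ≠ 0 ∧ J.IsPrimitive (c i)) ∧ (∀ i j, i ≠ j → J.mul (c i) (c j) = 0) ∧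
    ∑ i, c i = J.e

/-- `x = ∑ i, lam i • c i` is a spectral decomposition of `x`. -/
def IsSpectralDecomposition (x : V) (lam : Fin J.rank → ℝ) (c : Fin J.rank → V) : Prop :=
  J.IsJordanFrame c ∧ x = ∑ i, lam i • c i

/-- The vector of eigenvalues of `x`, i.e. the coefficients of a spectral decomposition
of `x`. (One always exists, and the coefficients are unique up to order.) -/
noncomputable def eigenvalues (x : V) : Fin J.rank → ℝ :=
  Classical.epsilon fun lam => ∃ c, J.IsSpectralDecomposition x lam c

/-- The trace: the sum of the eigenvalues. -/
noncomputable def trace (x : V) : ℝ := ∑ i, J.eigenvalues x i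

/-- The operator norm `max |λ_i(x)|` (the norm on `Fin J.rank → ℝ` is the sup norm). -/
noncomputable def opNorm (x : V) : ℝ := ‖J.eigenvalues x‖

end Algebra

section Scheme

variable {V : Type*} [NormedAddCommGroup V] [InnerProductSpace ℝ V]
  (J : EuclideanJordanAlgebra V)

/-- A minimizer of `f` over `s` (meaningful when one exists). -/
noncomputable def argminOn (f : V → ℝ) (s : Set V) : V :=
  Classical.epsilon fun p => p ∈ s ∧ IsMinOn f s p

/-- `Ω`, the interior of the cone of squares. -/
def Omega : Set V := interior {y : V | ∃ x : V, y = J.mul x x}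

/-- `v⁺`, the projection of `v` onto the closure of `Ω`. -/
noncomputable def posPart (v : V) : V := argminOn (fun x => ‖x - v‖) (closure J.Omega)

/-- The spectraplex `Δ(Ω)`. -/
def spectraplex : Set V := {x : V | x ∈ closure J.Omega ∧ ⟪J.e, x⟫_ℝ = 1}

/-- `u_μ(v)`, the minimizer over the spectraplex of `⟨u, v⟩ + (μ / 2) ‖u - ū‖_F²`. -/
noncomputable def smoothMin (ubar : V) (μ : ℝ) (v : V) : V :=
  argminOn (fun u => ⟪u, v⟫_ℝ + μ / 2 * ‖u - ubar‖ ^ 2) J.spectraplex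

/-- The variables `u_t`, `z_t`, `μ_t` of the smooth perceptron scheme. -/
structure SmoothState (V : Type*) where
  u : V
  z : V
  mu : ℝ

/-- Initialization: `u_0 = ū`, `μ_0 = 2`, `z_0 = u_{μ_0}(P u_0)`. -/
noncomputable def smoothInit (P : V →L[ℝ] V) (ubar : V) : SmoothState V :=
  ⟨ubar, J.smoothMin ubar 2 (P ubar), 2⟩

/-- One pass of the loop body, from iteration `t` to iteration `t + 1`. -/
noncomputable def smoothStep (P : V →L[ℝ] V) (ubar : V) (t : ℕ) (s : SmoothState V) :
    SmoothState V :=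
  let θ : ℝ := 2 / ((t : ℝ) + 3)
  let u' : V := (1 - θ) • (s.u + θ • s.z) + θ ^ 2 • J.smoothMin ubar s.mu (P s.u)
  let mu' : ℝ := (1 - θ) * s.mu
  ⟨u', (1 - θ) • s.z + θ • J.smoothMin ubar mu' (P u'), mu'⟩

/-- The values of the variables after `t` passes of the loop body. -/
noncomputable def smoothIter (P : V →L[ℝ] V) (ubar : V) : ℕ → SmoothState V
  | 0 => J.smoothInit P ubar
  | t + 1 => J.smoothStep P ubar t (smoothIter P ubar t)

/-- The condition of the while loop: `P u ∉ Ω` and `‖(P z)⁺‖_F > ‖z‖ / (4 r)`. -/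
def smoothGuard (P : V →L[ℝ] V) (s : SmoothState V) : Prop :=
  P s.u ∉ J.Omega ∧ 1 / (4 * (J.rank : ℝ)) * J.opNorm s.z < ‖J.posPart (P s.z)‖

/-- The scheme has not halted after `t` iterations: the condition of the while loop has held
at each of its tests so far, including the one that follows the `t`-th iteration. -/
def SmoothNotHalted (P : V →L[ℝ] V) (ubar : V) (t : ℕ) : Prop :=
  ∀ s ≤ t, J.smoothGuard P (J.smoothIter P ubar s)

end Scheme

end EuclideanJordanAlgebra

/-! The proof is Nesterov's excessive gap technique. The invariant, for all `w` in the spectraplex,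
is `½‖P z_t‖² ≤ -½‖P u_t‖² + ⟪w, P u_t⟫ + (μ_t/2)‖w - ubar‖²`, with `μ_t = 4/((t+1)(t+2))`
(`smoothIter_invariant`, `excessive_gap_step`). As `P u_t ∉ Ω`, some `v` in the spectraplex has `⟪v,
P u_t⟫ ≤ 0`; as `‖v - ubar‖² ≤ 2`, taking `w = v` gives `‖P z_t‖² ≤ 2 μ_t`.

The two facts about the spectraplex, and its convexity, come from self-duality of the cone of
squares (`exists_sq_iff`). This rests on the spectral theorem over frames of exactly `rank`
idempotents and on associativity of the trace form. For the latter, the Peirce reflection of an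
idempotent `c` is an automorphism, so it permutes primitive idempotents and preserves the trace;
hence the trace kills `V_{1/2}(c)`, which contains `[L_x, L_y] c`, and so `L_c` is symmetric. -/

namespace EuclideanJordanAlgebra

/-! ### Peirce decomposition of an idempotent and its reflection automorphism. -/

section Peirce

variable {V : Type*} [AddCommGroup V] [Module ℝ V] (J : EuclideanJordanAlgebra V)

/-- The full linearization of the Jordan identity. -/
theorem jordan_linearized (x y z w : V) :
    J.mul (J.mul x y) (J.mul z w) + J.mul (J.mul y z) (J.mul x w) + J.mul (J.mul z x) (J.mul y w)
      = J.mul x (J.mul (J.mul y z) w) + J.mul y (J.mul (J.mul z x) w)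
        + J.mul z (J.mul (J.mul x y) w) := by
  have h1 := J.jordan (x + y + z) w
  have h2 := J.jordan (x + y) w
  have h3 := J.jordan (y + z) w
  have h4 := J.jordan (z + x) w
  have h5 := J.jordan x w
  have h6 := J.jordan y w
  have h7 := J.jordan z w
  simp only [map_add, LinearMap.add_apply, J.mul_comm y x, J.mul_comm z y, J.mul_comm x z]
    at h1 h2 h3 h4 ⊢
  linear_combination (norm := module) (-(1 / 2 : ℝ)) • (h1 - h2 - h3 - h4 + h5 + h6 + h7)

/-- The linearized Jordan identity, as an identity between operators applied to `w`. -/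
theorem mul_mul_mul_apply (x y z w : V) :
    J.mul (J.mul x (J.mul y z)) w = J.mul x (J.mul (J.mul y z) w) + J.mul y (J.mul (J.mul z x) w)
        + J.mul z (J.mul (J.mul x y) w) - J.mul y (J.mul x (J.mul z w))
        - J.mul z (J.mul x (J.mul y w)) := by
  have h1 := J.jordan_linearized x y z w
  have h2 := J.jordan_linearized w y z x
  simp only [J.mul_comm] at h1 h2 ⊢
  linear_combination (norm := module) h1 - h2

theorem e_mul (x : V) : J.mul J.e x = x := by rw [J.mul_comm, J.mul_e]

variable {J} {c : V}

/-- `L_c` is a root of `X(2X - 1)(X - 1)`, so its eigenvalues lie in `{0, 1/2, 1}`: this is the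
Peirce decomposition. -/
theorem IsIdempotent.cubic (hc : J.IsIdempotent c) (w : V) :
    (2 : ℝ) • J.mul c (J.mul c (J.mul c w)) = (3 : ℝ) • J.mul c (J.mul c w) - J.mul c w := by
  have h := J.mul_mul_mul_apply c c c w
  rw [IsIdempotent] at hc
  simp only [hc] at h
  linear_combination (norm := module) h

/-- `D = [L_x, L_y]` is a derivation, so `c² = c` forces `D c = 2 c ∘ D c`. -/
theorem IsIdempotent.half_of_commutator (hc : J.IsIdempotent c) (x y : V) :
    J.mul c (J.mul x (J.mul y c) - J.mul y (J.mul x c))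
      = (1 / 2 : ℝ) • (J.mul x (J.mul y c) - J.mul y (J.mul x c)) := by
  have h := J.mul_mul_mul_apply x c c y
  rw [IsIdempotent] at hc
  simp only [hc, map_sub] at h ⊢
  simp only [J.mul_comm] at h ⊢
  linear_combination (norm := module) (1 / 2 : ℝ) • h

/-- Linearizing gives `[L_c, L_z] = 2 [L_c, L_{c∘z}]` for every `z`. On the `V₁` part `c ∘ z` this
says that the commutator is twice itself, on the `V₀` part `z - c ∘ z` that it is zero. -/
theorem IsIdempotent.mul_left_comm (hc : J.IsIdempotent c) {z : V}
    (hz : J.mul c (J.mul c z) = J.mul c z) (w : V) :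
    J.mul c (J.mul z w) = J.mul z (J.mul c w) := by
  have key : ∀ z, J.mul c (J.mul z w) - J.mul z (J.mul c w)
      = (2 : ℝ) • (J.mul c (J.mul (J.mul c z) w) - J.mul (J.mul c z) (J.mul c w)) := by
    intro z
    have h := J.jordan_linearized c c z w
    rw [IsIdempotent] at hc
    simp only [hc] at h
    simp only [J.mul_comm] at h ⊢
    linear_combination (norm := module) h
  have h1 := key (J.mul c z)
  have h2 := key (z - J.mul c z)
  simp only [hz, map_sub, LinearMap.sub_apply, sub_self, map_zero, LinearMap.zero_apply,
    smul_zero] at h1 h2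
  linear_combination (norm := module) h2 - h1

theorem IsIdempotent.mul_half_half (hc : J.IsIdempotent c) {a b : V}
    (ha : J.mul c a = (1 / 2 : ℝ) • a) (hb : J.mul c b = (1 / 2 : ℝ) • b) :
    J.mul c (J.mul c (J.mul a b)) = J.mul c (J.mul a b) := by
  have h := J.jordan_linearized a b c c
  rw [IsIdempotent] at hc
  simp only [hc, J.mul_comm _ c, ha, hb, map_smul, LinearMap.smul_apply, J.mul_comm b a] at h
  linear_combination (norm := module) -h

/-- The Peirce reflection: `1` on the Peirce spaces `V₁`, `V₀` and `-1` on `V_{1/2}`. -/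
noncomputable def peirceReflection (J : EuclideanJordanAlgebra V) (c : V) : V →ₗ[ℝ] V :=
  -- The polynomial `1 - 8(s - s²)` is `1` at `s = 0, 1` and `-1` at `s = 1/2`.
  LinearMap.id - (8 : ℝ) • (J.mul c - J.mul c ∘ₗ J.mul c)

theorem peirceReflection_apply (x : V) :
    J.peirceReflection c x = x - (8 : ℝ) • (J.mul c x - J.mul c (J.mul c x)) := rfl

theorem peirceReflection_half {x : V} (hx : J.mul c x = (1 / 2 : ℝ) • x) :
    J.peirceReflection c x = -x := by
  simp only [peirceReflection_apply, hx, map_smul]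
  module

theorem IsIdempotent.peirceReflection_peirceReflection (hc : J.IsIdempotent c) (x : V) :
    J.peirceReflection c (J.peirceReflection c x) = x := by
  have h1 := hc.cubic x
  have h2 := congrArg (J.mul c) h1
  simp only [map_smul, map_sub] at h2
  simp only [peirceReflection_apply, map_sub, map_smul]
  linear_combination (norm := module) (32 : ℝ) • h2 - (16 : ℝ) • h1

/-- The Peirce rules make `V₁ ⊕ V₀` and `V_{1/2}` the even and odd parts of a `ℤ/2`-grading, and the
reflection is its sign automorphism. -/
theorem IsIdempotent.peirceReflection_mul (hc : J.IsIdempotent c) (x y : V) :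
    J.peirceReflection c (J.mul x y)
      = J.mul (J.peirceReflection c x) (J.peirceReflection c y) := by
  have h0 : ∀ z w, J.mul c (J.mul c z) = J.mul c z →
      J.peirceReflection c (J.mul z w)
        = J.mul (J.peirceReflection c z) (J.peirceReflection c w) := by
    intro z w hz
    have hz' : J.peirceReflection c z = z := by simp [peirceReflection_apply, hz]
    rw [hz', peirceReflection_apply, peirceReflection_apply, hc.mul_left_comm hz,
      hc.mul_left_comm hz]
    simp only [map_sub, map_smul]
  have h2 : ∀ a b, J.mul c a = (1 / 2 : ℝ) • a → J.mul c b = (1 / 2 : ℝ) • b →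
      J.peirceReflection c (J.mul a b)
        = J.mul (J.peirceReflection c a) (J.peirceReflection c b) := by
    intro a b ha hb
    rw [peirceReflection_half ha, peirceReflection_half hb, peirceReflection_apply,
      hc.mul_half_half ha hb]
    simp
  have dec : ∀ x, ∃ z a, x = z + a ∧ J.mul c (J.mul c z) = J.mul c z ∧
      J.mul c a = (1 / 2 : ℝ) • a := by
    intro x
    have h := hc.cubic x
    have h' := congrArg (J.mul c) h
    simp only [map_smul, map_sub] at h'
    -- `4(s - s²)` is `1` at `1/2` and `0` at `0, 1`, so it projects onto `V_{1/2}`.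
    refine ⟨x - (4 : ℝ) • (J.mul c x - J.mul c (J.mul c x)),
      (4 : ℝ) • (J.mul c x - J.mul c (J.mul c x)), by abel, ?_, ?_⟩
    · simp only [map_smul, map_sub]
      linear_combination (norm := module) (2 : ℝ) • h' - h
    · simp only [map_smul, map_sub]
      linear_combination (norm := module) (-2 : ℝ) • h
  obtain ⟨z, a, rfl, hz, ha⟩ := dec x
  obtain ⟨w, b, rfl, hw, hb⟩ := dec y
  have e1 := h0 z (w + b) hz
  have e2 := h0 w a hw
  have e3 := h2 a b ha hb
  rw [J.mul_comm w a, J.mul_comm (J.peirceReflection c w)] at e2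
  simp only [map_add, LinearMap.add_apply] at e1 ⊢
  linear_combination (norm := module) e1 + e2 + e3

end Peirce

end EuclideanJordanAlgebra

namespace EuclideanJordanAlgebra

/-! ### Power associativity, orthogonal idempotents and the rank. -/

section Spectral

variable {V : Type*} [AddCommGroup V] [Module ℝ V] (J : EuclideanJordanAlgebra V)

theorem pow_eq_mul_pow_apply (x : V) (n : ℕ) : J.pow x n = ((J.mul x) ^ n) J.e := by
  induction n with
  | zero => simp [pow]
  | succ n ih => rw [pow_succ', Module.End.mul_apply, ← ih]; rfl

theorem commute_mul_pow (x : V) (n : ℕ) :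
    Commute (J.mul x) (J.mul (J.pow x n)) := by
  have h2 : Commute (J.mul x) (J.mul (J.mul x x)) := LinearMap.ext fun y => J.jordan x y
  have h3 : ∀ n, J.mul (J.pow x (n + 2)) = J.mul x * J.mul (J.pow x (n + 1))
      + J.mul (J.pow x n) * J.mul (J.mul x x) + J.mul x * J.mul (J.pow x (n + 1))
      - J.mul (J.pow x n) * (J.mul x * J.mul x) - J.mul x * (J.mul x * J.mul (J.pow x n)) := by
    intro n
    ext w
    have h := J.mul_mul_mul_apply x (J.pow x n) x w
    rw [J.mul_comm (J.pow x n) x] at h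
    exact h
  have he : J.mul J.e = 1 := LinearMap.ext fun y => J.e_mul y
  -- `h3` expresses `L_{x^{n+2}}` through the two preceding powers, `L_x` and `L_{x²}`; the
  -- induction therefore carries two consecutive powers and both commutations.
  have key : ∀ n, (Commute (J.mul x) (J.mul (J.pow x n)) ∧
      Commute (J.mul (J.mul x x)) (J.mul (J.pow x n))) ∧
      (Commute (J.mul x) (J.mul (J.pow x (n + 1))) ∧
      Commute (J.mul (J.mul x x)) (J.mul (J.pow x (n + 1)))) := by
    intro n
    induction n with
    | zero => simp [pow, he, J.mul_e, h2.symm]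
    | succ n ih =>
      obtain ⟨⟨a1, a2⟩, b1, b2⟩ := ih
      refine ⟨⟨b1, b2⟩, ?_, ?_⟩
      · rw [h3]
        exact (((((Commute.refl _).mul_right b1).add_right (a1.mul_right h2)).add_right
          ((Commute.refl _).mul_right b1)).sub_right (a1.mul_right
          ((Commute.refl _).mul_right (Commute.refl _)))).sub_right
          ((Commute.refl _).mul_right ((Commute.refl _).mul_right a1))
      · rw [h3]
        exact ((((h2.symm.mul_right b2).add_right (a2.mul_right (Commute.refl _))).add_right
          (h2.symm.mul_right b2)).sub_right (a2.mul_right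
          (h2.symm.mul_right h2.symm))).sub_right
          (h2.symm.mul_right (h2.symm.mul_right a2))
  exact (key n).1.1

/-- Power associativity: `p(x) ∘ q(x) = (p q)(x)` for polynomials `p`, `q`. -/
theorem aeval_mul_aeval (x : V) (p q : Polynomial ℝ) :
    J.mul (Polynomial.aeval (J.mul x) p J.e) (Polynomial.aeval (J.mul x) q J.e)
      = Polynomial.aeval (J.mul x) (p * q) J.e := by
  have hp : Commute (J.mul x) (J.mul (Polynomial.aeval (J.mul x) p J.e)) := by
    rw [Polynomial.aeval_eq_sum_range, LinearMap.sum_apply, map_sum]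
    refine Commute.sum_right _ _ _ fun i _ => ?_
    rw [LinearMap.smul_apply, map_smul, ← J.pow_eq_mul_pow_apply]
    exact (J.commute_mul_pow x i).smul_right _
  have hq : Commute (Polynomial.aeval (J.mul x) q)
      (J.mul (Polynomial.aeval (J.mul x) p J.e)) := by
    rw [Polynomial.aeval_eq_sum_range]
    exact Commute.sum_left _ _ _ fun i _ => (hp.pow_left i).smul_left _
  have h := LinearMap.congr_fun hq.eq J.e
  simp only [Module.End.mul_apply, J.mul_e] at h
  rw [← h, _root_.mul_comm, map_mul, Module.End.mul_apply]

/-- A Euclidean Jordan algebra carries an inner product for which multiplications are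
symmetric. -/
theorem exists_core : ∃ core : InnerProductSpace.Core ℝ V,
    ∀ x y z : V, core.inner (J.mul x y) z = core.inner y (J.mul x z) := by
  obtain ⟨B, hB, hpos⟩ := J.exists_form
  -- The associative form need not be symmetric, so it is symmetrized.
  refine ⟨{ inner := fun x y => B x y + B y x
            conj_inner_symm := fun x y => by simp [add_comm]
            re_inner_nonneg := fun x => ?_
            add_left := fun x y z => by simp only [map_add, LinearMap.add_apply]; ring
            smul_left := fun x y a => by
              simp only [map_smul, LinearMap.smul_apply, smul_eq_mul, conj_trivial]; ring
            definite := fun x hx => ?_ }, fun x y z => ?_⟩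
  · rcases eq_or_ne x 0 with rfl | hx
    · simp
    · have := hpos x hx
      simp only [RCLike.re_to_real]
      linarith
  · by_contra h
    have := hpos x h
    linarith
  · change B (J.mul x y) z + B z (J.mul x y) = B y (J.mul x z) + B (J.mul x z) y
    rw [J.mul_comm x y, hB, J.mul_comm x z, hB, J.mul_comm y x]

/-- Only the values of a polynomial at finitely many points matter for `p(L(x))`. -/
theorem exists_finset_aeval_eq [FiniteDimensional ℝ V] (x : V) :
    ∃ s : Finset ℝ, ∀ p q : Polynomial ℝ, (∀ a ∈ s, p.eval a = q.eval a) →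
      Polynomial.aeval (J.mul x) p = Polynomial.aeval (J.mul x) q := by
  obtain ⟨core, hcore⟩ := J.exists_core
  let : NormedAddCommGroup V := core.toNormedAddCommGroup
  let : InnerProductSpace ℝ V := .ofCore core.toCore
  have hsym : (J.mul x).IsSymmetric := fun y z => hcore x y z
  have hev := hsym.apply_eigenvectorBasis rfl
  refine ⟨Finset.univ.image (hsym.eigenvalues rfl), fun p q hpq => ?_⟩
  refine (hsym.eigenvectorBasis rfl).toBasis.ext fun i => ?_
  have hv : ∀ p : Polynomial ℝ, Polynomial.aeval (J.mul x) p (hsym.eigenvectorBasis rfl i)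
      = p.eval (hsym.eigenvalues rfl i) • (hsym.eigenvectorBasis rfl i) := fun p =>
    Module.End.aeval_apply_of_hasEigenvector (hsym.hasEigenvector_eigenvectorBasis rfl i)
  rw [OrthonormalBasis.coe_toBasis, hv, hv, hpq _ (by simp)]

/-- A complete system of nonzero pairwise orthogonal idempotents. -/
structure IsIdempotentSystem {ι : Type*} [Fintype ι] (c : ι → V) : Prop where
  ne_zero : ∀ i, c i ≠ 0
  idem : ∀ i, J.mul (c i) (c i) = c i
  orth : ∀ i j, i ≠ j → J.mul (c i) (c j) = 0
  sum_eq : ∑ i, c i = J.e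

/-- The idempotents are the Lagrange polynomials of the eigenvalues of `L_x`, evaluated at `x`. -/
theorem exists_isIdempotentSystem [FiniteDimensional ℝ V] (x : V) :
    ∃ (s : Finset ℝ) (c : s → V), J.IsIdempotentSystem c ∧ x = ∑ a : s, (a : ℝ) • c a := by
  classical
  obtain ⟨s, hs⟩ := J.exists_finset_aeval_eq x
  set b : ℝ → V := fun a => Polynomial.aeval (J.mul x) (Lagrange.basis s id a) J.e with hb
  have hev : ∀ i ∈ s, ∀ j ∈ s, (Lagrange.basis s id i).eval j = if i = j then 1 else 0 := by
    intro i hi j hj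
    split_ifs with h
    · subst h
      exact Lagrange.eval_basis_self (Function.injective_id.injOn) hi
    · exact Lagrange.eval_basis_of_ne (v := id) h hj
  have hmul : ∀ i ∈ s, ∀ j ∈ s, J.mul (b i) (b j) = if i = j then b i else 0 := by
    intro i hi j hj
    simp only [hb, aeval_mul_aeval]
    split_ifs with h
    · subst h
      rw [hs _ (Lagrange.basis s id i)]
      intro a ha
      rw [Polynomial.eval_mul, hev i hi a ha]
      split_ifs <;> simp
    · rw [hs _ 0]
      · simp
      intro a ha
      rw [Polynomial.eval_mul, hev i hi a ha, hev j hj a ha]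
      split_ifs <;> simp_all
  have hsum : ∑ i ∈ s, b i = J.e := by
    simp only [hb]
    rw [← LinearMap.sum_apply, ← map_sum, hs _ 1]
    · simp
    intro a ha
    rw [Polynomial.eval_finsetSum, Finset.sum_congr rfl fun i hi => hev i hi a ha]
    simp [ha]
  have hx : ∑ i ∈ s, i • b i = x := by
    simp only [hb]
    have h : ∀ i, i • Polynomial.aeval (J.mul x) (Lagrange.basis s id i) J.e
        = Polynomial.aeval (J.mul x) (Polynomial.C i * Lagrange.basis s id i) J.e := by
      intro i
      simp
    simp only [h]
    rw [← LinearMap.sum_apply, ← map_sum, hs _ Polynomial.X]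
    · simp [J.mul_e]
    intro a ha
    rw [Polynomial.eval_finsetSum, Finset.sum_congr rfl fun i hi => by
      rw [Polynomial.eval_mul, hev i hi a ha]]
    simp [ha]
  -- An eigenvalue of `L_x` need not be one of `x`; its idempotent is then zero and is dropped.
  refine ⟨s.filter fun a => b a ≠ 0, fun a => b a, ⟨fun a => (Finset.mem_filter.1 a.2).2,
    fun a => ?_, fun a a' h => ?_, ?_⟩, ?_⟩
  · rw [hmul _ (Finset.mem_filter.1 a.2).1 _ (Finset.mem_filter.1 a.2).1, if_pos rfl]
  · rw [hmul _ (Finset.mem_filter.1 a.2).1 _ (Finset.mem_filter.1 a'.2).1,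
      if_neg fun h' => h (Subtype.ext h')]
  · rw [Finset.sum_coe_sort _ b, Finset.sum_filter_ne_zero, hsum]
  · rw [Finset.sum_coe_sort _ fun a => a • b a, Finset.sum_filter, ← hx]
    refine Finset.sum_congr rfl fun a _ => ?_
    split_ifs with h
    · rfl
    · rw [not_not.1 h, smul_zero]

variable {J}

namespace IsIdempotentSystem

variable {ι : Type*} [Fintype ι] {c : ι → V}

theorem mul_sum_smul (hc : J.IsIdempotentSystem c) (lam : ι → ℝ) (j : ι) :
    J.mul (c j) (∑ i, lam i • c i) = lam j • c j := by
  classical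
  rw [map_sum, Finset.sum_eq_single j]
  · rw [map_smul, hc.idem]
  · intro i _ h
    rw [map_smul, hc.orth j i h.symm, smul_zero]
  · simp

theorem linearIndependent (hc : J.IsIdempotentSystem c) : LinearIndependent ℝ c := by
  rw [Fintype.linearIndependent_iff]
  intro g hg i
  have h := hc.mul_sum_smul g i
  rw [hg, map_zero] at h
  exact (smul_eq_zero.1 h.symm).resolve_right (hc.ne_zero i)

theorem sum_mul_sum (hc : J.IsIdempotentSystem c) (lam mu : ι → ℝ) :
    J.mul (∑ i, lam i • c i) (∑ i, mu i • c i) = ∑ i, (lam i * mu i) • c i := by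
  rw [map_sum (J.mul), LinearMap.sum_apply]
  refine Finset.sum_congr rfl fun i _ => ?_
  rw [map_smul, LinearMap.smul_apply, hc.mul_sum_smul, smul_smul]

theorem pow_sum (hc : J.IsIdempotentSystem c) (lam : ι → ℝ) (k : ℕ) :
    J.pow (∑ i, lam i • c i) k = ∑ i, lam i ^ k • c i := by
  induction k with
  | zero => simp [pow, hc.sum_eq]
  | succ k ih => rw [pow, ih, hc.sum_mul_sum]; simp only [pow_succ']

theorem le_card (hc : J.IsIdempotentSystem c) (lam : ι → ℝ) {k : ℕ}
    (h : LinearIndependent ℝ fun i : Fin k => J.pow (∑ i, lam i • c i) i) :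
    k ≤ Fintype.card ι := by
  have h1 := finrank_span_eq_card h
  rw [Fintype.card_fin] at h1
  rw [← h1]
  refine le_trans ?_ (finrank_range_le_card (R := ℝ) c)
  have : FiniteDimensional ℝ (Submodule.span ℝ (Set.range c)) :=
    FiniteDimensional.span_of_finite ℝ (Set.finite_range c)
  refine Submodule.finrank_mono (Submodule.span_le.2 ?_)
  rintro _ ⟨i, rfl⟩
  simp only [hc.pow_sum]
  exact Submodule.sum_mem _ fun j _ => Submodule.smul_mem _ _ (Submodule.subset_span ⟨j, rfl⟩)

end IsIdempotentSystem

variable (J)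

theorem rank_spec [FiniteDimensional ℝ V] (x : V) :
    ¬ LinearIndependent ℝ (fun i : Fin (J.rank + 1) => J.pow x i) := by
  have hne : {r : ℕ | ∀ x : V,
      ¬ LinearIndependent ℝ (fun i : Fin (r + 1) => J.pow x i)}.Nonempty := by
    refine ⟨Module.finrank ℝ V, fun x h => ?_⟩
    have := h.fintype_card_le_finrank
    simp at this
  exact Nat.sInf_mem hne x

theorem exists_linearIndependent_pow :
    ∃ x : V, LinearIndependent ℝ (fun i : Fin J.rank => J.pow x i) := by
  rcases Nat.eq_zero_or_pos J.rank with h | h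
  · refine ⟨0, ?_⟩
    have : IsEmpty (Fin J.rank) := by rw [h]; infer_instance
    exact linearIndependent_empty_type
  · have h1 : J.rank - 1 < J.rank := by omega
    have h2 := Nat.notMem_of_lt_sInf h1
    simp only [Set.mem_ofPred_eq, not_forall, not_not] at h2
    rwa [Nat.sub_add_cancel h] at h2

theorem IsIdempotentSystem.card_le_rank [FiniteDimensional ℝ V] {J : EuclideanJordanAlgebra V}
    {ι : Type*} [Fintype ι] {c : ι → V} (hc : J.IsIdempotentSystem c) :
    Fintype.card ι ≤ J.rank := by
  by_contra! hlt
  -- Distinct coefficients: by Vandermonde, `rank + 1` powers of this element would be independent.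
  set lam : ι → ℝ := fun i => ((Fintype.equivFin ι i : ℕ) : ℝ) with hlam
  refine J.rank_spec (∑ i, lam i • c i) (Fintype.linearIndependent_iff.2 fun g hg => ?_)
  simp only [hc.pow_sum, Finset.smul_sum, smul_smul] at hg
  rw [Finset.sum_comm] at hg
  simp only [← Finset.sum_smul] at hg
  have h := Fintype.linearIndependent_iff.1 hc.linearIndependent _ hg
  have h0 : g = 0 := by
    refine Matrix.eq_zero_of_forall_index_sum_pow_mul_eq_zero
      (f := fun k : Fin (J.rank + 1) => ((k : ℕ) : ℝ))
      (fun a b hab => Fin.ext (Nat.cast_injective (R := ℝ) hab)) fun j => ?_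
    have hj := h ((Fintype.equivFin ι).symm ⟨j, by omega⟩)
    simp only [hlam, Equiv.apply_symm_apply] at hj
    simpa [_root_.mul_comm] using hj
  exact fun i => congrFun h0 i

/-- Complete systems of maximal length are Jordan frames. -/
theorem IsIdempotentSystem.isJordanFrame [FiniteDimensional ℝ V] {J : EuclideanJordanAlgebra V}
    {c : Fin J.rank → V} (hc : J.IsIdempotentSystem c) : J.IsJordanFrame c := by
  refine ⟨fun i => ⟨hc.ne_zero i, hc.idem i, ?_⟩, hc.orth, hc.sum_eq⟩
  rintro ⟨a, b, ha, hb, hac, hbc, hab⟩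
  unfold IsIdempotent at ha hb
  have hab0 : J.mul a b = 0 := by
    have h := hc.idem i
    rw [← hab] at h
    simp only [map_add, LinearMap.add_apply, ha, hb, J.mul_comm b a] at h
    linear_combination (norm := module) (1 / 2 : ℝ) • h
  have ha0 : a ≠ 0 := by rintro rfl; exact hbc (by simpa using hab)
  have hb0 : b ≠ 0 := by rintro rfl; exact hac (by simpa using hab)
  -- Here `d ∈ V₁(c i)` and `c j ∈ V₀(c i)`. Both multiplications commute with `L_{c i}`, so `c i ∘
  -- (c j ∘ d)` equals both `c j ∘ d` and `0`.
  have horth : ∀ d, J.mul (c i) d = d → ∀ j, j ≠ i → J.mul d (c j) = 0 := by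
    intro d hd j hj
    have h := IsIdempotent.mul_left_comm (J := J) (c := c i) (hc.idem i) (z := c j)
      (by simp [hc.orth i j hj.symm]) d
    have h' := IsIdempotent.mul_left_comm (J := J) (c := c i) (hc.idem i) (z := d)
      (by simp [hd]) (c j)
    rw [hc.orth i j hj.symm, map_zero] at h'
    rw [hd, J.mul_comm (c j) d, h'] at h
    exact h.symm
  have hca : J.mul (c i) a = a := by
    rw [← hab, map_add, LinearMap.add_apply, ha, J.mul_comm b a, hab0, add_zero]
  have hcb : J.mul (c i) b = b := by
    rw [← hab, map_add, LinearMap.add_apply, hb, hab0, zero_add]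
  -- Replacing `c i` by `a` and `b` gives `rank + 1` orthogonal idempotents, one too many.
  have hsys : J.IsIdempotentSystem
      (fun o : Option (Fin J.rank) => o.elim a fun j => if j = i then b else c j) := by
    refine ⟨?_, ?_, ?_, ?_⟩
    · rintro (_ | j)
      · exact ha0
      · simp only [Option.elim]
        split_ifs
        exacts [hb0, hc.ne_zero j]
    · rintro (_ | j)
      · exact ha
      · simp only [Option.elim]
        split_ifs
        exacts [hb, hc.idem j]
    · rintro (_ | j) (_ | k) hjk
      · exact absurd rfl hjk
      · simp only [Option.elim]
        split_ifs with h
        exacts [hab0, horth a hca k h]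
      · simp only [Option.elim]
        split_ifs with h
        · rw [J.mul_comm, hab0]
        · rw [J.mul_comm, horth a hca j h]
      · have hjk' : j ≠ k := fun h => hjk (by rw [h])
        simp only [Option.elim]
        split_ifs with h h' h'
        · exact absurd (h.trans h'.symm) hjk'
        · exact horth b hcb k h'
        · rw [J.mul_comm, horth b hcb j h]
        · exact hc.orth j k hjk'
    · rw [Fintype.sum_option, ← hc.sum_eq]
      simp only [Option.elim]
      rw [← Finset.add_sum_erase _ _ (Finset.mem_univ i),
        ← Finset.add_sum_erase _ c (Finset.mem_univ i), if_pos rfl, ← hab, ← add_assoc]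
      congr 1
      exact Finset.sum_congr rfl fun j hj => if_neg (Finset.ne_of_mem_erase hj)
  have := hsys.card_le_rank
  simp at this

end Spectral

end EuclideanJordanAlgebra

namespace EuclideanJordanAlgebra

/-! ### The spectral theorem, by density of regular elements and compactness. -/

section Density

variable {V : Type*} [NormedAddCommGroup V] [InnerProductSpace ℝ V] [FiniteDimensional ℝ V]
  (J : EuclideanJordanAlgebra V)

/-- The product as a continuous bilinear map. -/
noncomputable def mulL : V →L[ℝ] V →L[ℝ] V :=
  LinearMap.toContinuousLinearMap
    ((LinearMap.toContinuousLinearMap : (V →ₗ[ℝ] V) ≃ₗ[ℝ] V →L[ℝ] V).toLinearMap ∘ₗ J.mul)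

theorem norm_mul_le (x y : V) : ‖J.mul x y‖ ≤ ‖J.mulL‖ * ‖x‖ * ‖y‖ :=
  J.mulL.le_opNorm₂ x y

/-- The elements whose powers `e, x, ..., x ^ (r - 1)` are linearly independent are dense. -/
theorem exists_linearIndependent_pow_near (x : V) {ε : ℝ} (hε : 0 < ε) :
    ∃ y, ‖y - x‖ < ε ∧ LinearIndependent ℝ (fun i : Fin J.rank => J.pow y i) := by
  obtain ⟨x0, hx0⟩ := J.exists_linearIndependent_pow
  -- The Gram determinant of the powers along the line from `x` to `x0` is analytic and nonzero at
  -- `1`, so it does not vanish identically near `0`.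
  set f : ℝ → ℝ := fun s =>
    (Matrix.gram ℝ fun i : Fin J.rank => J.pow (x + s • (x0 - x)) i).det with hf
  have hline : ∀ a : ℝ, AnalyticAt ℝ (fun s : ℝ => x + s • (x0 - x)) a := by
    intro a
    fun_prop
  have hpow : ∀ k, ∀ a : ℝ, AnalyticAt ℝ (fun s : ℝ => J.pow (x + s • (x0 - x)) k) a := by
    intro k
    induction k with
    | zero => exact fun a => analyticAt_const
    | succ k ih =>
      intro a
      exact (J.mulL.analyticAt_bilinear (x + a • (x0 - x), J.pow (x + a • (x0 - x)) k)).comp₂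
        (f := fun s : ℝ => x + s • (x0 - x)) (hline a) (ih a)
  have hfa : AnalyticOnNhd ℝ f Set.univ := by
    intro a _
    simp only [hf, Matrix.det_apply]
    refine Finset.analyticAt_fun_sum _ fun σ _ => AnalyticAt.const_smul ?_
    refine Finset.analyticAt_fun_prod _ fun i _ => ?_
    exact ((innerSL ℝ).analyticAt_bilinear (J.pow (x + a • (x0 - x)) (σ i),
      J.pow (x + a • (x0 - x)) i)).comp₂ (hpow _ a) (hpow _ a)
  have h1 : f 1 ≠ 0 := by
    simp only [hf, one_smul, add_sub_cancel]
    exact Matrix.det_gram_ne_zero_iff_linearIndependent.2 hx0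
  have h2 : ∀ᶠ s in nhdsWithin (0 : ℝ) {0}ᶜ, f s ≠ 0 := by
    by_contra h
    rw [← Filter.Frequently.eq_1] at h
    exact h1 (hfa.eqOn_zero_of_preconnected_of_frequently_eq_zero isPreconnected_univ
      (Set.mem_univ 0) h (Set.mem_univ 1))
  have h3 : ∀ᶠ s in nhdsWithin (0 : ℝ) {0}ᶜ, ‖(x + s • (x0 - x)) - x‖ < ε := by
    refine Filter.Eventually.filter_mono nhdsWithin_le_nhds ?_
    have hc : Continuous fun s : ℝ => ‖(x + s • (x0 - x)) - x‖ := by fun_prop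
    have := hc.tendsto 0
    simp only [zero_smul, add_zero, sub_self, norm_zero] at this
    exact this.eventually (gt_mem_nhds hε)
  obtain ⟨s, hs2, hs3⟩ := (h2.and h3).exists
  exact ⟨_, hs3, Matrix.det_gram_ne_zero_iff_linearIndependent.1 hs2⟩

/-- With `rank` independent powers, the number of spectral idempotents is at least `rank` by
`le_card` and at most `rank` by `card_le_rank`. -/
theorem exists_isIdempotentSystem_rank_near (x : V) {ε : ℝ} (hε : 0 < ε) :
    ∃ (lam : Fin J.rank → ℝ) (c : Fin J.rank → V), J.IsIdempotentSystem c ∧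
      ‖∑ i, lam i • c i - x‖ < ε := by
  obtain ⟨y, hy, hli⟩ := J.exists_linearIndependent_pow_near x hε
  obtain ⟨s, c, hc, hyc⟩ := J.exists_isIdempotentSystem y
  have hcard : Fintype.card s = J.rank := by
    refine le_antisymm hc.card_le_rank ?_
    rw [hyc] at hli
    exact hc.le_card _ hli
  set φ := (Fintype.equivFinOfCardEq hcard).symm
  refine ⟨fun i => φ i, c ∘ φ, ⟨fun i => hc.ne_zero _, fun i => hc.idem _,
    fun i j h => hc.orth _ _ (φ.injective.ne h), ?_⟩, ?_⟩
  · rw [← hc.sum_eq]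
    exact φ.sum_comp c
  · have : ∑ i, (φ i : ℝ) • (c ∘ φ) i = y := by
      rw [hyc]
      exact φ.sum_comp fun a => (a : ℝ) • c a
    rwa [this]

/-- The decomposition of `x` itself may have fewer than `rank` terms. Nearby elements have exactly
`rank`, and a limit of their frames and coefficients keeps that number. -/
theorem exists_isSpectralDecomposition_of_symmetric
    (hsym : ∀ x y z : V, ⟪J.mul x y, z⟫_ℝ = ⟪y, J.mul x z⟫_ℝ) (x : V) :
    ∃ lam c, J.IsSpectralDecomposition x lam c := by
  choose lam c hc hx using fun n : ℕ =>
    J.exists_isIdempotentSystem_rank_near x (ε := 1 / ((n : ℝ) + 1)) (by positivity)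
  set M := ‖J.mulL‖ with hM
  -- `c = c ∘ c` bounds the idempotents away from zero, so none vanishes in the limit.
  have hlow : ∀ n i, 1 ≤ M * ‖c n i‖ := by
    intro n i
    have h := J.norm_mul_le (c n i) (c n i)
    rw [(hc n).idem] at h
    have hp : 0 < ‖c n i‖ := norm_pos_iff.2 ((hc n).ne_zero i)
    by_contra! hlt
    nlinarith
  have hup : ∀ n i, ‖c n i‖ ≤ ‖J.e‖ := by
    intro n i
    have h : ‖c n i‖ ^ 2 = ⟪c n i, J.e⟫_ℝ := by
      rw [← real_inner_self_eq_norm_sq]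
      nth_rw 2 [← J.mul_e (c n i)]
      rw [← hsym, (hc n).idem]
    have h2 := real_inner_le_norm (c n i) J.e
    have hp : 0 < ‖c n i‖ := norm_pos_iff.2 ((hc n).ne_zero i)
    by_contra! hlt
    nlinarith
  have hlam : ∀ n i, ‖lam n i‖ ≤ M * (‖x‖ + 1) := by
    intro n i
    have h := J.norm_mul_le (c n i) (∑ j, lam n j • c n j)
    rw [(hc n).mul_sum_smul, norm_smul] at h
    have hp : 0 < ‖c n i‖ := norm_pos_iff.2 ((hc n).ne_zero i)
    have hy : ‖∑ j, lam n j • c n j‖ ≤ ‖x‖ + 1 := by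
      have h1 := norm_le_norm_add_norm_sub' (∑ j, lam n j • c n j) x
      have h2 := (hx n).le
      have h3 : 1 / ((n : ℝ) + 1) ≤ 1 := by
        rw [div_le_one (by positivity)]
        have : (0 : ℝ) ≤ n := Nat.cast_nonneg n
        linarith
      linarith
    have hMp : 0 ≤ M := norm_nonneg J.mulL
    have : ‖lam n i‖ * ‖c n i‖ ≤ (M * (‖x‖ + 1)) * ‖c n i‖ := by
      calc _ ≤ M * ‖c n i‖ * ‖∑ j, lam n j • c n j‖ := h
        _ ≤ M * ‖c n i‖ * (‖x‖ + 1) := by gcongr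
        _ = _ := by ring
    exact le_of_mul_le_mul_right this hp
  set R := max ‖J.e‖ (M * (‖x‖ + 1)) with hR
  have hR0 : 0 ≤ R := (norm_nonneg _).trans (le_max_left _ _)
  have hbd : ∀ n, (lam n, c n) ∈ Metric.closedBall (0 : (Fin J.rank → ℝ) × (Fin J.rank → V)) R := by
    intro n
    rw [mem_closedBall_zero_iff, Prod.norm_def, max_le_iff, pi_norm_le_iff_of_nonneg hR0,
      pi_norm_le_iff_of_nonneg hR0]
    exact ⟨fun i => (hlam n i).trans (le_max_right _ _), fun i => (hup n i).trans (le_max_left _ _)⟩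
  obtain ⟨⟨l, d⟩, -, φ, hφ, hlim⟩ := tendsto_subseq_of_bounded Metric.isBounded_closedBall hbd
  have hl : ∀ i, Filter.Tendsto (fun n => lam (φ n) i) Filter.atTop (nhds (l i)) := fun i =>
    ((continuous_apply i).comp continuous_fst).continuousAt.tendsto.comp hlim
  have hd : ∀ i, Filter.Tendsto (fun n => c (φ n) i) Filter.atTop (nhds (d i)) := fun i =>
    ((continuous_apply i).comp continuous_snd).continuousAt.tendsto.comp hlim
  have hmul : ∀ i j, Filter.Tendsto (fun n => J.mul (c (φ n) i) (c (φ n) j)) Filter.atTop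
      (nhds (J.mul (d i) (d j))) := fun i j =>
    (J.mulL.continuous₂.tendsto (d i, d j)).comp ((hd i).prodMk_nhds (hd j))
  have hsys : J.IsIdempotentSystem d := by
    refine ⟨fun i h0 => ?_, fun i => ?_, fun i j hij => ?_, ?_⟩
    · have := ge_of_tendsto' ((hd i).norm.const_mul M) fun n => hlow (φ n) i
      rw [h0, norm_zero, mul_zero] at this
      linarith
    · refine tendsto_nhds_unique (hmul i i) ?_
      simpa only [(hc _).idem] using hd i
    · refine tendsto_nhds_unique (hmul i j) ?_
      simp only [(hc _).orth i j hij]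
      exact tendsto_const_nhds
    · refine tendsto_nhds_unique (tendsto_finsetSum Finset.univ fun i _ => hd i) ?_
      simp only [(hc _).sum_eq]
      exact tendsto_const_nhds
  refine ⟨l, d, hsys.isJordanFrame, ?_⟩
  refine tendsto_nhds_unique (f := fun n => ∑ i, lam (φ n) i • c (φ n) i) (l := Filter.atTop) ?_
    (tendsto_finsetSum Finset.univ fun i _ => (hl i).smul (hd i))
  rw [tendsto_iff_norm_sub_tendsto_zero]
  refine squeeze_zero (fun n => norm_nonneg _) (fun n => (hx (φ n)).le) ?_
  exact tendsto_one_div_add_atTop_nhds_zero_nat.comp hφ.tendsto_atTop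

end Density

/-- The spectral theorem: every element has a spectral decomposition over a Jordan frame. -/
theorem exists_isSpectralDecomposition {V : Type*} [AddCommGroup V] [Module ℝ V]
    [FiniteDimensional ℝ V] (J : EuclideanJordanAlgebra V) (x : V) :
    ∃ lam c, J.IsSpectralDecomposition x lam c := by
  obtain ⟨core, hcore⟩ := J.exists_core
  let : NormedAddCommGroup V := core.toNormedAddCommGroup
  let : InnerProductSpace ℝ V := .ofCore core.toCore
  exact J.exists_isSpectralDecomposition_of_symmetric hcore x

end EuclideanJordanAlgebra

namespace EuclideanJordanAlgebra

/-! ### The trace of primitive idempotents. -/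

section Frames

variable {V : Type*} [AddCommGroup V] [Module ℝ V] {J : EuclideanJordanAlgebra V}

theorem IsJordanFrame.isIdempotentSystem {c : Fin J.rank → V} (hc : J.IsJordanFrame c) :
    J.IsIdempotentSystem c :=
  ⟨fun i => (hc.1 i).1, fun i => (hc.1 i).2.1, hc.2.1, hc.2.2⟩

theorem eigenvalues_spec [FiniteDimensional ℝ V] (x : V) :
    ∃ c, J.IsSpectralDecomposition x (J.eigenvalues x) c :=
  Classical.epsilon_spec (J.exists_isSpectralDecomposition x)

/-- The trace of a primitive idempotent is `1`. -/
theorem IsPrimitive.trace_eq_one [FiniteDimensional ℝ V] {c : V} (hc : J.IsPrimitive c)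
    (hc0 : c ≠ 0) : J.trace c = 1 := by
  obtain ⟨d, hd, hcd⟩ := eigenvalues_spec (J := J) c
  have hs := hd.isIdempotentSystem
  rw [trace]
  -- Any spectral decomposition will do, so uniqueness of eigenvalues is not needed.
  generalize J.eigenvalues c = lam at hcd
  have hidem : J.mul c c = c := hc.1
  have hmul : ∀ j, J.mul (d j) c = lam j • d j := fun j => by rw [hcd, hs.mul_sum_smul]
  have hlam : ∀ j, lam j = 0 ∨ lam j = 1 := by
    intro j
    have h := hmul j
    nth_rw 1 [← hidem] at h
    rw [hcd, hs.sum_mul_sum, hs.mul_sum_smul] at h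
    have h' : lam j * lam j = lam j := smul_left_injective ℝ (hs.ne_zero j) h
    rcases eq_or_ne (lam j) 0 with h0 | h0
    · exact Or.inl h0
    · exact Or.inr (mul_left_cancel₀ h0 (by rw [h', mul_one]))
  obtain ⟨j, hj⟩ : ∃ j, lam j = 1 := by
    -- If no coefficient were `1`, all would be `0`.
    by_contra! h
    refine hc0 ?_
    rw [hcd]
    exact Finset.sum_eq_zero fun i _ => by rw [(hlam i).resolve_right (h i), zero_smul]
  have hjc : J.mul (d j) c = d j := by rw [hmul, hj, one_smul]
  have hdj : d j = c := by
    by_contra hne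
    refine hc.2 ⟨d j, c - d j, hs.idem j, ?_, hne, ?_, by abel⟩
    · simp only [IsIdempotent, map_sub, LinearMap.sub_apply, hidem, hjc, hs.idem,
        J.mul_comm c (d j)]
      abel
    · simpa using hs.ne_zero j
  have hoff : ∀ i, i ≠ j → lam i = 0 := by
    intro i hi
    have h := hmul i
    rw [← hdj, hs.orth i j hi] at h
    exact (smul_eq_zero.1 h.symm).resolve_right (hs.ne_zero i)
  rw [Finset.sum_eq_single j (fun i _ hi => hoff i hi) (by simp), hj]

theorem IsIdempotent.isPrimitive_peirceReflection {c d : V} (hc : J.IsIdempotent c)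
    (hd : J.IsPrimitive d) : J.IsPrimitive (J.peirceReflection c d) := by
  have hid : ∀ a, J.IsIdempotent a → J.IsIdempotent (J.peirceReflection c a) := by
    intro a ha
    rw [IsIdempotent, ← hc.peirceReflection_mul, ha]
  refine ⟨hid d hd.1, ?_⟩
  rintro ⟨a, b, ha, hb, had, hbd, hab⟩
  refine hd.2 ⟨_, _, hid a ha, hid b hb, ?_, ?_, ?_⟩
  · rintro rfl
    exact had (hc.peirceReflection_peirceReflection a).symm
  · rintro rfl
    exact hbd (hc.peirceReflection_peirceReflection b).symm
  · rw [← map_add, hab, hc.peirceReflection_peirceReflection]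

end Frames

/-! ### Associativity of the trace form, self-duality, geometry of the spectraplex. -/

section TraceForm

variable {V : Type*} [NormedAddCommGroup V] [InnerProductSpace ℝ V]
  {J : EuclideanJordanAlgebra V} (hJ : ∀ x y : V, ⟪x, y⟫_ℝ = J.trace (J.mul x y))

include hJ

/-- The trace is defined through a choice of eigenvalues; this is what makes it linear. -/
theorem trace_eq_inner (x : V) : J.trace x = ⟪x, J.e⟫_ℝ := by rw [hJ, J.mul_e]

theorem trace_sum_smul {ι : Type*} [Fintype ι] (lam : ι → ℝ) (c : ι → V) :
    J.trace (∑ i, lam i • c i) = ∑ i, lam i * J.trace (c i) := by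
  simp only [trace_eq_inner hJ, sum_inner, real_inner_smul_left]

variable [FiniteDimensional ℝ V]

theorem IsIdempotent.trace_peirceReflection {c : V} (hc : J.IsIdempotent c) (x : V) :
    J.trace (J.peirceReflection c x) = J.trace x := by
  obtain ⟨lam, d, hd, rfl⟩ := J.exists_isSpectralDecomposition x
  simp only [map_sum, map_smul]
  rw [trace_sum_smul hJ, trace_sum_smul hJ]
  refine Finset.sum_congr rfl fun i _ => ?_
  rw [(hd.1 i).2.trace_eq_one (hd.1 i).1,
    (hc.isPrimitive_peirceReflection (hd.1 i).2).trace_eq_one fun h => (hd.1 i).1 ?_]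
  rw [← hc.peirceReflection_peirceReflection (d i), h, map_zero]

theorem IsIdempotent.trace_half {c x : V} (hc : J.IsIdempotent c)
    (hx : J.mul c x = (1 / 2 : ℝ) • x) : J.trace x = 0 := by
  have h := hc.trace_peirceReflection hJ x
  rw [peirceReflection_half hx, trace_eq_inner hJ, trace_eq_inner hJ, inner_neg_left] at h
  rw [trace_eq_inner hJ]
  linarith

/-- The trace of `[L_x, L_y] c ∈ V_{1/2}(c)` vanishes, which reads `⟪x, y ∘ c⟫ = ⟪y, x ∘ c⟫`. -/
theorem IsIdempotent.inner_mul_left {c : V} (hc : J.IsIdempotent c) (x y : V) :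
    ⟪J.mul c x, y⟫_ℝ = ⟪x, J.mul c y⟫_ℝ := by
  have h := hc.trace_half hJ (hc.half_of_commutator x y)
  rw [trace_eq_inner hJ, inner_sub_left, ← trace_eq_inner hJ, ← trace_eq_inner hJ, ← hJ, ← hJ,
    J.mul_comm y c, J.mul_comm x c, real_inner_comm _ y] at h
  linarith [real_inner_comm x (J.mul c y), real_inner_comm y (J.mul c x)]

theorem inner_mul_left (x y z : V) : ⟪J.mul x y, z⟫_ℝ = ⟪y, J.mul x z⟫_ℝ := by
  obtain ⟨lam, c, hc, rfl⟩ := J.exists_isSpectralDecomposition x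
  simp only [map_sum, map_smul, LinearMap.sum_apply, LinearMap.smul_apply, sum_inner, inner_sum,
    real_inner_smul_left, real_inner_smul_right]
  exact Finset.sum_congr rfl fun i _ => by
    rw [IsIdempotent.inner_mul_left hJ (hc.1 i).2.1]

theorem IsIdempotent.inner_sq_nonneg {c : V} (hc : J.IsIdempotent c) (y : V) :
    0 ≤ ⟪c, J.mul y y⟫_ℝ := by
  have hsym := hc.inner_mul_left hJ
  rw [← EuclideanJordanAlgebra.inner_mul_left hJ, J.mul_comm y c]
  have h1 := hsym y y
  have h2 := hsym (J.mul c y) y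
  have h3 := hsym (J.mul c (J.mul c y)) y
  have h4 := hsym (J.mul c (J.mul c y)) (J.mul c y)
  have h5 := congrArg (fun v => ⟪v, y⟫_ℝ) (hc.cubic y)
  have h6 := congrArg (fun v => ⟪v, J.mul c y⟫_ℝ) (hc.cubic y)
  simp only [inner_sub_left, real_inner_smul_left] at h5 h6
  -- On `{0, 1/2, 1}` one has `s = s² + 4(s - s²)²`, so `⟪L_c y, y⟫ = ‖L_c y‖² + 4‖L_c y - L_c²
  -- y‖²`.
  have h7 := real_inner_self_nonneg (x := J.mul c y)
  have h8 := real_inner_self_nonneg (x := J.mul c y - J.mul c (J.mul c y))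
  have h9 := real_inner_comm (J.mul c y) (J.mul c (J.mul c y))
  simp only [inner_sub_left, inner_sub_right] at h8
  linarith

theorem IsJordanFrame.inner_eq {c : Fin J.rank → V} (hc : J.IsJordanFrame c) (i j : Fin J.rank) :
    ⟪c i, c j⟫_ℝ = if i = j then 1 else 0 := by
  rw [hJ]
  split_ifs with h
  · rw [← h, hc.isIdempotentSystem.idem, (hc.1 i).2.trace_eq_one (hc.1 i).1]
  · rw [hc.2.1 i j h, trace_eq_inner hJ, inner_zero_left]

theorem IsJordanFrame.inner_sum_smul {c : Fin J.rank → V} (hc : J.IsJordanFrame c)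
    (lam : Fin J.rank → ℝ) (i : Fin J.rank) : ⟪c i, ∑ j, lam j • c j⟫_ℝ = lam i := by
  simp [inner_sum, real_inner_smul_right, hc.inner_eq hJ]

theorem IsPrimitive.inner_self {c : V} (hc : J.IsPrimitive c) (hc0 : c ≠ 0) :
    ⟪c, c⟫_ℝ = 1 := by
  rw [hJ, hc.1, hc.trace_eq_one hc0]

theorem IsPrimitive.inner_e {c : V} (hc : J.IsPrimitive c) (hc0 : c ≠ 0) :
    ⟪c, J.e⟫_ℝ = 1 := by
  rw [← trace_eq_inner hJ, hc.trace_eq_one hc0]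

/-- Self-duality of the cone of squares, tested on primitive idempotents. -/
theorem exists_sq_iff (y : V) : (∃ x, y = J.mul x x) ↔
    ∀ c, J.IsPrimitive c → c ≠ 0 → 0 ≤ ⟪c, y⟫_ℝ := by
  constructor
  · rintro ⟨x, rfl⟩ c hc -
    exact hc.1.inner_sq_nonneg hJ x
  · intro h
    obtain ⟨lam, c, hc, rfl⟩ := J.exists_isSpectralDecomposition y
    refine ⟨∑ i, √(lam i) • c i, ?_⟩
    rw [hc.isIdempotentSystem.sum_mul_sum]
    refine Finset.sum_congr rfl fun i _ => ?_
    have := h (c i) (hc.1 i).2 (hc.1 i).1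
    rw [hc.inner_sum_smul hJ] at this
    rw [Real.mul_self_sqrt this]

theorem inner_nonneg_of_mem_closure {x c : V} (hx : x ∈ closure J.Omega)
    (hc : J.IsPrimitive c) (hc0 : c ≠ 0) : 0 ≤ ⟪c, x⟫_ℝ := by
  have hcl : IsClosed {y : V | 0 ≤ ⟪c, y⟫_ℝ} :=
    isClosed_le continuous_const (continuous_const.inner continuous_id)
  refine closure_minimal (fun y hy => ?_) hcl hx
  have hy' : y ∈ {y : V | ∃ x : V, y = J.mul x x} := interior_subset hy
  exact (exists_sq_iff hJ y).1 hy' c hc hc0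

theorem inner_nonneg_of_mem_closure_of_mem_closure {x y : V} (hx : x ∈ closure J.Omega)
    (hy : y ∈ closure J.Omega) : 0 ≤ ⟪x, y⟫_ℝ := by
  obtain ⟨lam, c, hc, rfl⟩ := J.exists_isSpectralDecomposition x
  simp only [sum_inner, real_inner_smul_left]
  refine Finset.sum_nonneg fun i _ => mul_nonneg ?_
    (inner_nonneg_of_mem_closure hJ hy (hc.1 i).2 (hc.1 i).1)
  rw [← hc.inner_sum_smul hJ lam i]
  exact inner_nonneg_of_mem_closure hJ hx (hc.1 i).2 (hc.1 i).1

/-- Elements with positive eigenvalues lie in `Ω`. -/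
theorem IsJordanFrame.sum_smul_mem_Omega {c : Fin J.rank → V} (hc : J.IsJordanFrame c)
    {lam : Fin J.rank → ℝ} (hlam : ∀ i, 0 < lam i) : ∑ i, lam i • c i ∈ J.Omega := by
  obtain ⟨δ, hδ, hle⟩ : ∃ δ > 0, ∀ i, δ ≤ lam i := by
    rcases isEmpty_or_nonempty (Fin J.rank) with h | h
    · exact ⟨1, one_pos, fun i => h.elim i⟩
    · obtain ⟨i, hi⟩ := Finite.exists_min lam
      exact ⟨lam i, hlam i, hi⟩
  -- Radius `δ` suffices: a primitive `d` has norm `1` and `⟪d, e⟫ = 1`, so its product with the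
  -- centre is at least `δ`.
  refine mem_interior.2 ⟨Metric.ball (∑ i, lam i • c i) δ, fun y hy => ?_, Metric.isOpen_ball,
    Metric.mem_ball_self hδ⟩
  refine (exists_sq_iff hJ y).2 fun d hd hd0 => ?_
  have hnn : ∀ i, 0 ≤ ⟪d, c i⟫_ℝ := fun i =>
    (exists_sq_iff hJ (c i)).1 ⟨c i, (hc.isIdempotentSystem.idem i).symm⟩ d hd hd0
  have h1 : δ ≤ ⟪d, ∑ i, lam i • c i⟫_ℝ := by
    have h2 : ∑ i, ⟪d, c i⟫_ℝ = 1 := by rw [← inner_sum, hc.2.2, hd.inner_e hJ hd0]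
    calc δ = ∑ i, δ * ⟪d, c i⟫_ℝ := by rw [← Finset.mul_sum, h2, mul_one]
      _ ≤ ∑ i, lam i * ⟪d, c i⟫_ℝ :=
        Finset.sum_le_sum fun i _ => mul_le_mul_of_nonneg_right (hle i) (hnn i)
      _ = _ := by simp only [inner_sum, real_inner_smul_right]
  have hn : ‖d‖ = 1 := by
    have := hd.inner_self hJ hd0
    rw [real_inner_self_eq_norm_sq] at this
    exact (pow_eq_one_iff_of_nonneg (norm_nonneg d) two_ne_zero).1 this
  have h3 := abs_le.1 (abs_real_inner_le_norm d (y - ∑ i, lam i • c i))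
  rw [hn, one_mul, inner_sub_right] at h3
  rw [mem_ball_iff_norm] at hy
  linarith [h3.1]

theorem IsJordanFrame.mem_closure_Omega {c : Fin J.rank → V} (hc : J.IsJordanFrame c)
    (i : Fin J.rank) : c i ∈ closure J.Omega := by
  have hlim : Filter.Tendsto (fun s : ℝ => c i + s • J.e) (nhdsWithin 0 (Set.Ioi 0))
      (nhds (c i)) := by
    have h : Continuous fun s : ℝ => c i + s • J.e := by fun_prop
    have := (h.tendsto 0).mono_left (nhdsWithin_le_nhds (s := Set.Ioi 0))
    simpa using this
  refine mem_closure_of_tendsto hlim (eventually_nhdsWithin_of_forall fun s hs => ?_)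
  have hs' : 0 < s := hs
  have : c i + s • J.e = ∑ j, ((if j = i then 1 else 0) + s) • c j := by
    simp only [add_smul, Finset.sum_add_distrib, ← Finset.smul_sum, hc.2.2]
    simp
  rw [this]
  refine hc.sum_smul_mem_Omega hJ fun j => ?_
  split_ifs <;> linarith

/-- Off `Ω`, some point of the spectraplex has nonpositive inner product. -/
theorem exists_mem_spectraplex_inner_nonpos {w : V} (hw : w ∉ J.Omega) :
    ∃ v ∈ J.spectraplex, ⟪v, w⟫_ℝ ≤ 0 := by
  obtain ⟨lam, c, hc, rfl⟩ := J.exists_isSpectralDecomposition w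
  obtain ⟨i, hi⟩ : ∃ i, lam i ≤ 0 := by
    by_contra! h
    exact hw (hc.sum_smul_mem_Omega hJ h)
  refine ⟨c i, ⟨hc.mem_closure_Omega hJ i, ?_⟩, ?_⟩
  · rw [real_inner_comm, (hc.1 i).2.inner_e hJ (hc.1 i).1]
  · rwa [hc.inner_sum_smul hJ]

theorem norm_sq_le_one_of_mem_spectraplex {x : V} (hx : x ∈ J.spectraplex) : ‖x‖ ^ 2 ≤ 1 := by
  obtain ⟨lam, c, hc, rfl⟩ := J.exists_isSpectralDecomposition x
  have hnn : ∀ i, 0 ≤ lam i := fun i => by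
    rw [← hc.inner_sum_smul hJ lam i]
    exact inner_nonneg_of_mem_closure hJ hx.1 (hc.1 i).2 (hc.1 i).1
  have h1 : ∑ i, lam i = 1 := by
    have h : ⟪J.e, ∑ i, lam i • c i⟫_ℝ = 1 := hx.2
    rw [← hc.2.2, sum_inner] at h
    simpa only [hc.inner_sum_smul hJ] using h
  have h2 : ‖∑ i, lam i • c i‖ ^ 2 = ∑ i, lam i * lam i := by
    rw [← real_inner_self_eq_norm_sq, sum_inner]
    simp only [real_inner_smul_left, hc.inner_sum_smul hJ]
  rw [h2, ← h1]
  refine Finset.sum_le_sum fun i _ => mul_le_of_le_one_left (hnn i) ?_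
  rw [← h1]
  exact Finset.single_le_sum (fun i _ => hnn i) (Finset.mem_univ i)

/-- Self-duality makes the cross term `⟪x, y⟫` nonnegative, giving `2` where the triangle inequality
would give `4`. -/
theorem norm_sub_sq_le_two_of_mem_spectraplex {x y : V} (hx : x ∈ J.spectraplex)
    (hy : y ∈ J.spectraplex) : ‖x - y‖ ^ 2 ≤ 2 := by
  rw [norm_sub_sq_real]
  linarith [norm_sq_le_one_of_mem_spectraplex hJ hx, norm_sq_le_one_of_mem_spectraplex hJ hy,
    inner_nonneg_of_mem_closure_of_mem_closure hJ hx.1 hy.1]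

theorem convex_spectraplex : Convex ℝ J.spectraplex := by
  have hK : Convex ℝ {y : V | ∃ x : V, y = J.mul x x} := by
    intro x hx y hy a b ha hb _
    refine (exists_sq_iff hJ _).2 fun c hc hc0 => ?_
    rw [inner_add_right, real_inner_smul_right, real_inner_smul_right]
    exact add_nonneg (mul_nonneg ha ((exists_sq_iff hJ x).1 hx c hc hc0))
      (mul_nonneg hb ((exists_sq_iff hJ y).1 hy c hc hc0))
  exact hK.interior.closure.inter
    (convex_hyperplane (f := fun x => ⟪J.e, x⟫_ℝ) (innerₛₗ ℝ J.e).isLinear 1)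

end TraceForm

theorem isClosed_spectraplex {V : Type*} [NormedAddCommGroup V] [InnerProductSpace ℝ V]
    (J : EuclideanJordanAlgebra V) : IsClosed J.spectraplex :=
  isClosed_closure.inter (isClosed_eq (continuous_const.inner continuous_id) continuous_const)

end EuclideanJordanAlgebra

namespace EuclideanJordanAlgebra

/-! ### Quadratic growth and the excessive gap step. -/

section Scheme

variable {V : Type*} [NormedAddCommGroup V] [InnerProductSpace ℝ V]

/-- A minimizer of the strongly convex function `⟪u, v⟫ + (μ / 2) ‖u - a‖²` over a convex set
satisfies the quadratic growth inequality. -/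
theorem quadratic_growth {s : Set V} (hs : Convex ℝ s) {a v p : V} {μ : ℝ}
    (hp : p ∈ s) (hmin : IsMinOn (fun u => ⟪u, v⟫_ℝ + μ / 2 * ‖u - a‖ ^ 2) s p) {w : V}
    (hw : w ∈ s) :
    ⟪p, v⟫_ℝ + μ / 2 * ‖p - a‖ ^ 2 + μ / 2 * ‖w - p‖ ^ 2 ≤ ⟪w, v⟫_ℝ + μ / 2 * ‖w - a‖ ^ 2 := by
  -- Compare `p` with `p + τ(w - p)` and divide by `τ`; `τ → 0` then yields the first-order
  -- condition.
  have key : ∀ τ ∈ Set.Ioc (0 : ℝ) 1,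
      0 ≤ ⟪w - p, v⟫_ℝ + μ * ⟪p - a, w - p⟫_ℝ + τ * (μ / 2 * ‖w - p‖ ^ 2) := by
    rintro τ ⟨h0, h1⟩
    have hm := hmin (hs.add_smul_sub_mem hp hw ⟨h0.le, h1⟩)
    simp only [Set.mem_ofPred_eq] at hm
    have e : p + τ • (w - p) - a = (p - a) + τ • (w - p) := by abel
    rw [e, norm_add_sq_real, norm_smul, inner_add_left, real_inner_smul_left,
      real_inner_smul_right, mul_pow, Real.norm_eq_abs, sq_abs] at hm
    refine nonneg_of_mul_nonneg_right ?_ h0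
    linarith
  have hlim : Filter.Tendsto
      (fun τ : ℝ => ⟪w - p, v⟫_ℝ + μ * ⟪p - a, w - p⟫_ℝ + τ * (μ / 2 * ‖w - p‖ ^ 2))
      (nhdsWithin 0 (Set.Ioi 0)) (nhds (⟪w - p, v⟫_ℝ + μ * ⟪p - a, w - p⟫_ℝ)) := by
    have h : Continuous fun τ : ℝ =>
      ⟪w - p, v⟫_ℝ + μ * ⟪p - a, w - p⟫_ℝ + τ * (μ / 2 * ‖w - p‖ ^ 2) := by fun_prop
    have := (h.tendsto 0).mono_left (nhdsWithin_le_nhds (s := Set.Ioi 0))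
    simpa using this
  have h := ge_of_tendsto hlim (Filter.mem_of_superset (Ioc_mem_nhdsGT one_pos) key)
  have e : w - a = (p - a) + (w - p) := by abel
  rw [e, norm_add_sq_real]
  rw [inner_sub_left] at h
  linarith

/-- The excessive gap inequality is preserved by one step of the scheme. -/
theorem excessive_gap_step {P : V →L[ℝ] V} (hP : ∀ x y : V, ⟪x, P y⟫_ℝ = ⟪P x, P y⟫_ℝ)
    (hP1 : ∀ x, ‖P x‖ ≤ ‖x‖) {u z q q' a : V} {μ θ : ℝ} (hθ0 : 0 ≤ θ) (hθ1 : θ ≤ 1)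
    (hμ : θ ^ 2 ≤ (1 - θ) * μ)
    (hgap : 1 / 2 * ‖P z‖ ^ 2 ≤ -(1 / 2) * ‖P u‖ ^ 2 + ⟪q, P u⟫_ℝ + μ / 2 * ‖q - a‖ ^ 2)
    (hgrow : ⟪q, P u⟫_ℝ + μ / 2 * ‖q - a‖ ^ 2 + μ / 2 * ‖q' - q‖ ^ 2
      ≤ ⟪q', P u⟫_ℝ + μ / 2 * ‖q' - a‖ ^ 2) :
    1 / 2 * ‖P ((1 - θ) • z + θ • q')‖ ^ 2
      ≤ -(1 / 2) * ‖P ((1 - θ) • (u + θ • z) + θ ^ 2 • q)‖ ^ 2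
        + ⟪q', P ((1 - θ) • (u + θ • z) + θ ^ 2 • q)⟫_ℝ + (1 - θ) * μ / 2 * ‖q' - a‖ ^ 2 := by
  have hd : θ ^ 2 * ‖P q' - P q‖ ^ 2 ≤ (1 - θ) * μ * ‖q' - q‖ ^ 2 := by
    rw [← map_sub]
    have := hP1 (q' - q)
    calc _ ≤ θ ^ 2 * ‖q' - q‖ ^ 2 := by gcongr
      _ ≤ _ := by gcongr
  -- Put `W = (1-θ) P z + θ P q`. The new projections are `(1-θ) P u + θ W` and `W + θ(P q' - P q)`.
  -- `h1` is the convexity defect of the squared norm at the first; `hd` absorbs the quadratic term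
  -- of the second into the growth term; what remains is `h2`.
  have h1 : 0 ≤ θ * (1 - θ) * ‖P u - ((1 - θ) • P z + θ • P q)‖ ^ 2 :=
    mul_nonneg (mul_nonneg hθ0 (by linarith)) (sq_nonneg _)
  have h2 : 0 ≤ (1 - θ) * ‖P z - ((1 - θ) • P z + θ • P q)‖ ^ 2 :=
    mul_nonneg (by linarith) (sq_nonneg _)
  have h3 := mul_le_mul_of_nonneg_left (add_le_add hgap hgrow) (by linarith : 0 ≤ 1 - θ)
  rw [hP q' (_ + _)]
  rw [hP q' u] at h3
  simp only [map_add, map_smul]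
  simp only [← real_inner_self_eq_norm_sq (P _), ← real_inner_self_eq_norm_sq (_ - (_ + _)),
    ← real_inner_self_eq_norm_sq (P _ - P _), ← real_inner_self_eq_norm_sq (_ + _),
    inner_add_left, inner_add_right, inner_sub_left, inner_sub_right, real_inner_smul_left,
    real_inner_smul_right] at h1 h2 h3 hd ⊢
  simp only [real_inner_comm (P u) (P z), real_inner_comm (P u) (P q), real_inner_comm (P u) (P q'),
    real_inner_comm (P z) (P q), real_inner_comm (P z) (P q'),
    real_inner_comm (P q) (P q')] at h1 h2 h3 hd ⊢
  linarith

end Scheme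

/-! ### The invariant along the iterates and the final bound. -/

section Iterates

variable {V : Type*} [NormedAddCommGroup V] [InnerProductSpace ℝ V] [FiniteDimensional ℝ V]
  {J : EuclideanJordanAlgebra V}

theorem smoothMin_spec {ubar : V} (hu : ubar ∈ J.spectraplex) {μ : ℝ} (hμ : 0 < μ) (v : V) :
    J.smoothMin ubar μ v ∈ J.spectraplex ∧
      IsMinOn (fun u => ⟪u, v⟫_ℝ + μ / 2 * ‖u - ubar‖ ^ 2) J.spectraplex
        (J.smoothMin ubar μ v) := by
  refine Classical.epsilon_spec
    (p := fun p => p ∈ J.spectraplex ∧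
      IsMinOn (fun u => ⟪u, v⟫_ℝ + μ / 2 * ‖u - ubar‖ ^ 2) J.spectraplex p) ?_
  have hcont : Continuous fun u : V => ⟪u, v⟫_ℝ + μ / 2 * ‖u - ubar‖ ^ 2 := by fun_prop
  refine hcont.continuousOn.exists_isMinOn' J.isClosed_spectraplex hu ?_
  refine Filter.Eventually.filter_mono inf_le_left ?_
  -- Beyond this radius the quadratic term outweighs `‖v‖ ‖u - ubar‖`, so the objective is at least
  -- its value at `ubar`.
  have hlarge : ∀ᶠ u in Filter.cocompact V, 2 * ‖v‖ / μ ≤ ‖u - ubar‖ := by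
    have := (Homeomorph.subRight ubar).isClosedEmbedding.tendsto_cocompact
    exact ((tendsto_norm_cocompact_atTop (E := V)).comp this).eventually_ge_atTop _
  filter_upwards [hlarge] with u hlu
  rw [div_le_iff₀ hμ] at hlu
  have h1 := (abs_le.1 (abs_real_inner_le_norm (u - ubar) v)).1
  rw [inner_sub_left] at h1
  simp only [sub_self, norm_zero]
  nlinarith [norm_nonneg (u - ubar)]

variable (hJ : ∀ x y : V, ⟪x, y⟫_ℝ = J.trace (J.mul x y))

include hJ

theorem smoothIter_invariant {P : V →L[ℝ] V} (hP : ∀ x y : V, ⟪x, P y⟫_ℝ = ⟪P x, P y⟫_ℝ)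
    (hP1 : ∀ x, ‖P x‖ ≤ ‖x‖) {ubar : V} (hu : ubar ∈ J.spectraplex) (t : ℕ) :
    (J.smoothIter P ubar t).mu = 4 / (((t : ℝ) + 1) * (t + 2)) ∧
    ∀ w ∈ J.spectraplex, 1 / 2 * ‖P (J.smoothIter P ubar t).z‖ ^ 2
      ≤ -(1 / 2) * ‖P (J.smoothIter P ubar t).u‖ ^ 2 + ⟪w, P (J.smoothIter P ubar t).u⟫_ℝ
        + (J.smoothIter P ubar t).mu / 2 * ‖w - ubar‖ ^ 2 := by
  have hmu_pos : ∀ t : ℕ, 0 < 4 / (((t : ℝ) + 1) * (t + 2)) := fun t => by positivity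
  induction t with
  | zero =>
    simp only [smoothIter, smoothInit]
    refine ⟨by norm_num, fun w hw => ?_⟩
    obtain ⟨hq, hmin⟩ := smoothMin_spec hu two_pos (P ubar)
    have h1 := hmin hw
    simp only [Set.mem_ofPred_eq] at h1
    -- With `μ₀ = 2` the proximal term is `‖q - ubar‖²`, which dominates `½‖P q - P ubar‖²`.
    generalize J.smoothMin ubar 2 (P ubar) = q at *
    have h2 : ‖P q - P ubar‖ ^ 2 ≤ ‖q - ubar‖ ^ 2 := by
      rw [← map_sub]
      have := hP1 (q - ubar)
      gcongr
    rw [norm_sub_sq_real, ← hP] at h2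
    have h3 := sq_nonneg ‖q - ubar‖
    linarith
  | succ t ih =>
    obtain ⟨hmu, hgap⟩ := ih
    simp only [smoothIter, smoothStep]
    generalize J.smoothIter P ubar t = s at *
    have ht : (0 : ℝ) ≤ t := Nat.cast_nonneg t
    have hθ1 : 2 / ((t : ℝ) + 3) ≤ 1 := by
      rw [div_le_one (by positivity)]
      linarith
    -- The factor `1 - θ_t = (t+1)/(t+3)` telescopes.
    have hmu' : (1 - 2 / ((t : ℝ) + 3)) * s.mu
        = 4 / ((((t + 1 : ℕ) : ℝ) + 1) * ((t + 1 : ℕ) + 2)) := by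
      rw [hmu]
      push_cast
      field_simp
      ring
    -- That is, `4/(t+3)² ≤ 4/((t+2)(t+3))`.
    have hθ2 : (2 / ((t : ℝ) + 3)) ^ 2 ≤ (1 - 2 / ((t : ℝ) + 3)) * s.mu := by
      rw [hmu', div_pow, div_le_div_iff₀ (by positivity) (by positivity)]
      push_cast
      nlinarith
    refine ⟨hmu', fun w hw => ?_⟩
    obtain ⟨hq, hmin⟩ := smoothMin_spec hu (hmu ▸ hmu_pos t : 0 < s.mu) (P s.u)
    obtain ⟨hq', hmin'⟩ := smoothMin_spec hu (hmu' ▸ hmu_pos (t + 1) :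
      0 < (1 - 2 / ((t : ℝ) + 3)) * s.mu) (P ((1 - 2 / ((t : ℝ) + 3)) • (s.u + (2 / ((t : ℝ) + 3))
        • s.z) + (2 / ((t : ℝ) + 3)) ^ 2 • J.smoothMin ubar s.mu (P s.u)))
    have h1 := hmin' hw
    simp only [Set.mem_ofPred_eq] at h1
    have h2 := excessive_gap_step hP hP1 (a := ubar) (by positivity) hθ1 hθ2 (hgap _ hq)
      (quadratic_growth (convex_spectraplex hJ) hq hmin hq')
    linarith

end Iterates

end EuclideanJordanAlgebra

theorem mainTheorem11 {V : Type*} [NormedAddCommGroup V] [InnerProductSpace ℝ V]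
    [FiniteDimensional ℝ V] (J : EuclideanJordanAlgebra V)
    (h_inner : ∀ x y : V, ⟪x, y⟫_ℝ = J.trace (J.mul x y))
    (L : Submodule ℝ V) (ubar : V) (h_ubar : ubar ∈ J.spectraplex)
    (t : ℕ) (ht : 1 ≤ t) (h_run : J.SmoothNotHalted L.starProjection ubar t) :
    ‖L.starProjection (J.smoothIter L.starProjection ubar t).z‖ ^ 2
      ≤ 8 / ((t : ℝ) + 1) ^ 2 := by
  have hP : ∀ x y : V, ⟪x, L.starProjection y⟫_ℝ
      = ⟪L.starProjection x, L.starProjection y⟫_ℝ := fun x y => by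
    rw [L.inner_starProjection_left_eq_right,
      L.starProjection_eq_self_iff.2 (L.starProjection_apply_mem y)]
  obtain ⟨hmu, hgap⟩ := EuclideanJordanAlgebra.smoothIter_invariant h_inner hP
    L.norm_starProjection_apply_le h_ubar t
  -- The loop test at iterate `t` itself gives `P u_t ∉ Ω`.
  obtain ⟨v, hv, hv0⟩ := EuclideanJordanAlgebra.exists_mem_spectraplex_inner_nonpos h_inner
    (h_run t le_rfl).1
  have h1 := hgap v hv
  have h2 := EuclideanJordanAlgebra.norm_sub_sq_le_two_of_mem_spectraplex h_inner hv h_ubar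
  have h3 := sq_nonneg ‖L.starProjection (J.smoothIter L.starProjection ubar t).u‖
  have hmu0 : 0 ≤ (J.smoothIter L.starProjection ubar t).mu := by
    rw [hmu]
    positivity
  have h4 := mul_le_mul_of_nonneg_left h2 hmu0
  calc _ ≤ 2 * (J.smoothIter L.starProjection ubar t).mu := by linarith
    _ = 8 / (((t : ℝ) + 1) * (t + 2)) := by rw [hmu]; ring
    _ ≤ 8 / ((t : ℝ) + 1) ^ 2 := by
      rw [sq]
      gcongr
      linarith
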